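/- Let $G\subseteq\mathbb C$ be a simply connected domain (a nonempty, open, path-connected set in which every closed curve can be shrunk to a point without leaving $G$), and let $f$ be analytic in $G$, that is, complex differentiable at every point of $G$. By a curve in $G$ we mean a piecewise continuously differentiable map $\gamma:[a,b]\to G$; it is closed if $\gamma(a)=\gamma(b)$. The line integral of $f$ along such a curve is $$\int_\gamma f(z)\,dz=\int_a^b f(\gamma(t))\,\gamma'(t)\,dt ,$$ and this integral exists. Moreover: 1. (Cauchy–Goursat) For every closed curve $C$ in $G$, $\displaystyle\oint_C f(z)\,dz=0$. 2. (Corollary) For any two points $A,B\in G$ the integral of $f$ along a curve in $G$ from $A$ to $B$ is independent of the curve: if $L_1$ and $L_2$ are curves in $G$ from $A$ to $B$, then $\displaystyle\int_{L_1}f(z)\,dz=\int_{L_2}f(z)\,dz$. -/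

import Mathlib

/-- `γ`, restricted to the parameter interval `[a, b]`, is a piecewise continuously differentiable
curve in the plane: it is continuous on `[a, b]`, and there are finitely many break points such
that `γ` is continuously differentiable (one-sidedly at the ends) on every closed subinterval
whose interior contains no break point. -/
structure IsPiecewiseC1Curve (γ : ℝ → ℂ) (a b : ℝ) : Prop where
  le : a ≤ b
  continuousOn : ContinuousOn γ (Set.Icc a b)
  exists_breakpoints : ∃ s : Finset ℝ, ∀ c d : ℝ, a ≤ c → c < d → d ≤ b →
    (∀ t ∈ s, t ∉ Set.Ioo c d) → ContDiffOn ℝ 1 γ (Set.Icc c d)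

/-- `γ` on `[a, b]` is a piecewise continuously differentiable curve all of whose points lie
in `G`. -/
def IsCurveIn (G : Set ℂ) (γ : ℝ → ℂ) (a b : ℝ) : Prop :=
  IsPiecewiseC1Curve γ a b ∧ ∀ t ∈ Set.Icc a b, γ t ∈ G

/-- The integrand `f (γ t) * γ' t` of the line integral of `f` along `γ`. -/
noncomputable def lineIntegrand (f : ℂ → ℂ) (γ : ℝ → ℂ) (t : ℝ) : ℂ :=
  f (γ t) * deriv γ t

/-- The line integral of `f` along the curve `γ : [a, b] → ℂ`,
that is, the integral of `f (γ t) * γ' t` from `a` to `b`. -/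
noncomputable def lineIntegral (f : ℂ → ℂ) (γ : ℝ → ℂ) (a b : ℝ) : ℂ :=
  ∫ t in a..b, lineIntegrand f γ t

open Filter Topology Set

/-! ### Primitives on simply connected open sets

The germs of primitives of `f` form a covering space of every open set on which `f` has local
primitives. Over a simply connected open set this covering has a global section. -/

/-! Everything follows from a global primitive `g` of `f` on `G`: on the smooth pieces of a curve
`(g ∘ γ)' = f(γ) γ'`, so the integral is `g (γ b) - g (γ a)` (`lineIntegral_eq_sub`). Primitives
exist on discs and locally differ by constants, so their germs cover `G`; lifting the inclusion of
`G` selects one germ at each point, and the values of these germs form `g`. Curves are never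
deformed. -/

/-- `F` is a primitive of `f` on a neighbourhood of `z`. -/
def IsPrimitiveNear (f F : ℂ → ℂ) (z : ℂ) : Prop :=
  ∀ᶠ w in 𝓝 z, HasDerivAt F (f w) w

/-- `⟨z, w⟩` stands for the germ at `z` of the primitive of `f` with value `w` at `z`. -/
@[ext]
structure PrimitiveGerm (f : ℂ → ℂ) where
  /-- The base point of the germ. -/
  proj : ℂ
  /-- The value of the germ at its base point. -/
  val : ℂ

/-- The set of possible constants of integration, with the discrete topology. -/
@[ext]
structure IntegrationConstant where
  /-- The underlying complex number. -/
  val : ℂ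

instance : TopologicalSpace IntegrationConstant := ⊥

instance : DiscreteTopology IntegrationConstant := ⟨rfl⟩

namespace PrimitiveGerm

variable {f : ℂ → ℂ}

/-- The germs at the points `z'` of the primitive `F`, normalized to have value `w` at `z`. -/
def germAt (f F : ℂ → ℂ) (z w z' : ℂ) : PrimitiveGerm f := ⟨z', w + (F z' - F z)⟩

/-- A set of germs is open if with every germ it contains the germs at nearby points of the
same local primitive. -/
instance : TopologicalSpace (PrimitiveGerm f) where
  IsOpen S := ∀ e ∈ S, ∀ F, IsPrimitiveNear f F e.proj → ∀ᶠ z in 𝓝 e.proj, germAt f F e.proj e.val z ∈ S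
  isOpen_univ := fun _ _ _ _ => Eventually.of_forall fun _ => mem_univ _
  isOpen_inter := fun _ _ hS hT e he F hF => (hS e he.1 F hF).and (hT e he.2 F hF)
  isOpen_sUnion := fun _ h e ⟨S, hS, he⟩ F hF =>
    (h S hS e he F hF).mono fun _ hz => ⟨S, hS, hz⟩

theorem isOpen_iff {S : Set (PrimitiveGerm f)} : IsOpen S ↔
    ∀ e ∈ S, ∀ F, IsPrimitiveNear f F e.proj → ∀ᶠ z in 𝓝 e.proj, germAt f F e.proj e.val z ∈ S :=
  Iff.rfl

end PrimitiveGerm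

theorem IsPrimitiveNear.eventually_sub_eq {f F F' : ℂ → ℂ} {z : ℂ} (hF : IsPrimitiveNear f F z)
    (hF' : IsPrimitiveNear f F' z) : ∀ᶠ w in 𝓝 z, F w - F z = F' w - F' z := by
  obtain ⟨r, hr, hball⟩ := Metric.eventually_nhds_iff_ball.1 (hF.and hF')
  filter_upwards [Metric.ball_mem_nhds z hr] with w hw
  have hderiv : ∀ x ∈ Metric.ball z r, HasDerivAt (F - F') 0 x := fun x hx => by
    simpa using (hball x hx).1.sub (hball x hx).2
  have := Metric.isOpen_ball.is_const_of_deriv_eq_zero (convex_ball z r).isPreconnected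
    (fun x hx => (hderiv x hx).differentiableAt.differentiableWithinAt)
    (fun x hx => (hderiv x hx).deriv) hw (Metric.mem_ball_self hr)
  simp only [Pi.sub_apply] at this
  linear_combination this

namespace PrimitiveGerm

variable {f : ℂ → ℂ}

/-- Openness of a set of germs tests every local primitive; as these differ by constants, a single
one already determines the neighbourhoods. -/
theorem nhds_eq_map {F : ℂ → ℂ} {z : ℂ} (w : ℂ) (hF : IsPrimitiveNear f F z) :
    𝓝 (⟨z, w⟩ : PrimitiveGerm f) = map (germAt f F z w) (𝓝 z) := by
  ext S
  rw [mem_map]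
  constructor
  · intro hS
    obtain ⟨T, hTS, hT, hz⟩ := mem_nhds_iff.1 hS
    exact (isOpen_iff.1 hT _ hz F hF).mono fun _ h => hTS h
  · intro hS
    -- `V` is also chosen so that `F` is a primitive near each of its points and can be compared
    -- there with any `F'`.
    obtain ⟨V, hV, hVo, hzV⟩ := mem_nhds_iff.1 (inter_mem hS hF)
    refine mem_nhds_iff.2 ⟨germAt f F z w '' V, ?_, isOpen_iff.2 ?_, z, hzV, ?_⟩
    · rintro _ ⟨z', hz', rfl⟩
      exact (hV hz').1
    · rintro _ ⟨z', hz', rfl⟩ F' hF'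
      have hFz' : IsPrimitiveNear f F z' :=
        eventually_of_mem (hVo.mem_nhds hz') fun _ h => (hV h).2
      filter_upwards [hFz'.eventually_sub_eq hF', hVo.mem_nhds hz'] with y hy hyV
      refine ⟨y, hyV, PrimitiveGerm.ext rfl ?_⟩
      change w + (F y - F z) = w + (F z' - F z) + (F' y - F' z')
      rw [← hy]
      ring
    · exact PrimitiveGerm.ext rfl (by simp [germAt])

/-- A primitive on an open set trivializes the projection of the germs over this set. -/
def trivialization {F : ℂ → ℂ} {U : Set ℂ} (hU : IsOpen U) (hF : ∀ z ∈ U, HasDerivAt F (f z) z) :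
    Bundle.Trivialization IntegrationConstant (proj : PrimitiveGerm f → ℂ) where
  -- Subtracting `F` makes the fibre coordinate constant along the germs of one primitive, hence
  -- continuous into a discrete space.
  toFun e := (e.proj, ⟨e.val - F e.proj⟩)
  invFun x := ⟨x.1, x.2.val + F x.1⟩
  source := proj ⁻¹' U
  target := U ×ˢ univ
  map_source' := fun _ he => ⟨he, mem_univ _⟩
  map_target' := fun _ hx => hx.1
  left_inv' := fun e _ => PrimitiveGerm.ext rfl (sub_add_cancel _ _)
  right_inv' := fun x _ => Prod.ext rfl (IntegrationConstant.ext (add_sub_cancel_right _ _))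
  open_source := isOpen_iff.2 fun _ he _ _ => hU.mem_nhds he
  open_target := hU.prod isOpen_univ
  continuousOn_toFun := by
    rintro ⟨z, w⟩ (hz : z ∈ U)
    have hnear : IsPrimitiveNear f F z := eventually_of_mem (hU.mem_nhds hz) hF
    refine ContinuousAt.continuousWithinAt ?_
    rw [ContinuousAt, nhds_eq_map w hnear, tendsto_map'_iff, nhds_prod_eq]
    refine Tendsto.prodMk tendsto_id (tendsto_const_nhds.congr fun z' =>
      IntegrationConstant.ext ?_)
    change w - F z = w + (F z' - F z) - F z'
    ring
  continuousOn_invFun := by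
    rintro ⟨z, c⟩ ⟨hz : z ∈ U, -⟩
    have hnear : IsPrimitiveNear f F z := eventually_of_mem (hU.mem_nhds hz) hF
    refine ContinuousAt.continuousWithinAt ?_
    rw [ContinuousAt, nhds_eq_map _ hnear, nhds_prod_eq,
      nhds_discrete IntegrationConstant, prod_pure,
      tendsto_map'_iff]
    refine Tendsto.congr (f₁ := germAt f F z (c.val + F z)) (fun z' => PrimitiveGerm.ext rfl ?_)
      tendsto_map
    change c.val + F z + (F z' - F z) = c.val + F z'
    ring
  baseSet := U
  open_baseSet := hU
  source_eq := rfl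
  target_eq := rfl
  proj_toFun := fun _ _ => rfl

theorem isCoveringMapOn_proj {G : Set ℂ} (hG : IsOpen G) (hf : DifferentiableOn ℂ f G) :
    IsCoveringMapOn (proj : PrimitiveGerm f → ℂ) G := by
  intro z hz
  obtain ⟨r, hr, hball⟩ := Metric.isOpen_iff.1 hG z hz
  obtain ⟨F, hF⟩ := (hf.mono hball).isExactOn_ball
  exact (IsEvenlyCovered.of_trivialization (t := trivialization Metric.isOpen_ball hF)
    (Metric.mem_ball_self hr)).to_isEvenlyCovered_preimage

end PrimitiveGerm

open PrimitiveGerm in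
/-- A holomorphic function on a simply connected open set has a primitive. -/
theorem DifferentiableOn.isExactOn_of_isSimplyConnected {f : ℂ → ℂ} {G : Set ℂ}
    (hf : DifferentiableOn ℂ f G) (hG : IsOpen G) (hGsc : IsSimplyConnected G) :
    Complex.IsExactOn f G := by
  classical
  have := hGsc.simplyConnectedSpace
  have := hG.locallyPathConnectedSpace
  obtain ⟨z₀, hz₀⟩ := hGsc.nonempty
  obtain ⟨Φ, ⟨-, hΦ⟩, -⟩ := (isCoveringMapOn_proj hG hf).existsUnique_continuousMap_lifts
    (⟨Subtype.val, continuous_subtype_val⟩ : C(G, ℂ)) (a₀ := ⟨z₀, hz₀⟩)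
    (e₀ := ⟨z₀, 0⟩) rfl Subtype.property
  refine ⟨fun z => if hz : z ∈ G then (Φ ⟨z, hz⟩).val else 0, fun z hz => ?_⟩
  obtain ⟨r, hr, hball⟩ := Metric.isOpen_iff.1 hG z hz
  obtain ⟨F, hF⟩ := (hf.mono hball).isExactOn_ball
  have hnear : IsPrimitiveNear f F z := eventually_of_mem (Metric.ball_mem_nhds z hr) hF
  have hfst : ∀ x, (Φ x).proj = x := fun x => congrFun hΦ x
  have hlim := Φ.continuous.tendsto ⟨z, hz⟩
  rw [show Φ ⟨z, hz⟩ = ⟨z, (Φ ⟨z, hz⟩).val⟩ from PrimitiveGerm.ext (hfst _) rfl, nhds_eq_map _ hnear] at hlim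
  have hev : ∀ᶠ x : G in 𝓝 ⟨z, hz⟩, (Φ x).val = (Φ ⟨z, hz⟩).val + (F x - F z) := by
    -- By continuity, `Φ x` is eventually a germ of the same local primitive; comparing base points
    -- identifies which one.
    refine (hlim.eventually (range_mem_map (f := 𝓝 z))).mono ?_
    rintro x ⟨y, hy⟩
    have hyx : y = x := (congrArg PrimitiveGerm.proj hy).trans (hfst x)
    rw [← hy, ← hyx]
    rfl
  rw [nhds_subtype_eq_comap, eventually_comap] at hev
  refine (((hF z (Metric.mem_ball_self hr)).sub_const (F z)).const_add
    (Φ ⟨z, hz⟩).val).congr_of_eventuallyEq ?_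
  filter_upwards [hev, hG.mem_nhds hz] with y hy hyG
  simpa [hyG] using hy ⟨y, hyG⟩ rfl

/-! ### Line integrals along piecewise continuously differentiable curves -/

theorem ContDiffOn.intervalIntegrable_lineIntegrand {f : ℂ → ℂ} {γ : ℝ → ℂ} {a b : ℝ}
    (hab : a < b) (hγ : ContDiffOn ℝ 1 γ (Icc a b)) (hf : ContinuousOn (f ∘ γ) (Icc a b)) :
    IntervalIntegrable (lineIntegrand f γ) MeasureTheory.volume a b := by
  have hcont : ContinuousOn (fun t => f (γ t) * derivWithin γ (Icc a b) t) (Icc a b) :=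
    hf.mul (hγ.continuousOn_derivWithin (uniqueDiffOn_Icc hab) le_rfl)
  -- `deriv` and `derivWithin` can disagree only at the end points, a null set.
  refine (hcont.intervalIntegrable_of_Icc hab.le).congr_ae ?_
  rw [uIoc_of_le hab.le, ← MeasureTheory.restrict_Ioo_eq_restrict_Ioc]
  refine MeasureTheory.ae_restrict_of_forall_mem measurableSet_Ioo fun t ht => ?_
  simp only [lineIntegrand, derivWithin_of_mem_nhds (Icc_mem_nhds ht.1 ht.2)]

theorem intervalIntegrable_lineIntegrand_of_breakpoints {f : ℂ → ℂ} {γ : ℝ → ℂ} (s : Finset ℝ) :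
    ∀ {a b : ℝ}, a ≤ b → ContinuousOn (f ∘ γ) (Icc a b) →
      (∀ c d : ℝ, a ≤ c → c < d → d ≤ b → (∀ t ∈ s, t ∉ Ioo c d) →
        ContDiffOn ℝ 1 γ (Icc c d)) →
      IntervalIntegrable (lineIntegrand f γ) MeasureTheory.volume a b := by
  induction s using Finset.strongInduction with
  | H s ih =>
    intro a b hab hf hγ
    by_cases hs : ∃ t ∈ s, t ∈ Ioo a b
    · obtain ⟨t, hts, hat, htb⟩ := hs
      have hlt := Finset.erase_ssubset hts
      -- Once the interval is split at `t`, this break point is an end point of both halves and can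
      -- be erased.
      refine (ih _ hlt hat.le (hf.mono (Icc_subset_Icc_right htb.le)) ?_).trans
        (ih _ hlt htb.le (hf.mono (Icc_subset_Icc_left hat.le)) ?_)
      · refine fun c d hc hcd hd h => hγ c d hc hcd (hd.trans htb.le) fun u hu hucd => ?_
        exact h u (Finset.mem_erase.2 ⟨(hucd.2.trans_le hd).ne, hu⟩) hucd
      · refine fun c d hc hcd hd h => hγ c d (hat.le.trans hc) hcd hd fun u hu hucd => ?_
        exact h u (Finset.mem_erase.2 ⟨(hc.trans_lt hucd.1).ne', hu⟩) hucd
    · push Not at hs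
      rcases hab.eq_or_lt with rfl | hlt
      · exact IntervalIntegrable.refl
      · exact (hγ a b le_rfl hlt le_rfl hs).intervalIntegrable_lineIntegrand hlt hf

namespace IsCurveIn

variable {G : Set ℂ} {f g : ℂ → ℂ} {γ : ℝ → ℂ} {a b : ℝ}

theorem intervalIntegrable_lineIntegrand (hγ : IsCurveIn G γ a b) (hf : ContinuousOn f G) :
    IntervalIntegrable (lineIntegrand f γ) MeasureTheory.volume a b := by
  obtain ⟨s, hs⟩ := hγ.1.exists_breakpoints
  exact intervalIntegrable_lineIntegrand_of_breakpoints s hγ.1.le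
    (hf.comp hγ.1.continuousOn hγ.2) hs

theorem lineIntegral_eq_sub (hγ : IsCurveIn G γ a b) (hf : ContinuousOn f G)
    (hg : ∀ z ∈ G, HasDerivAt g (f z) z) : lineIntegral f γ a b = g (γ b) - g (γ a) := by
  obtain ⟨s, hs⟩ := hγ.1.exists_breakpoints
  have hgc : ContinuousOn g G := fun z hz => (hg z hz).continuousAt.continuousWithinAt
  -- This form of the fundamental theorem needs only continuity at the break points.
  refine MeasureTheory.integral_eq_of_hasDerivAt_off_countable_of_le (g ∘ γ) _ hγ.1.le
    s.countable_toSet (hgc.comp hγ.1.continuousOn hγ.2) (fun t ht => ?_)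
    (hγ.intervalIntegrable_lineIntegrand hf)
  obtain ⟨c, d, htcd, hcd⟩ := mem_nhds_iff_exists_Ioo_subset.1
    (inter_mem (Ioo_mem_nhds ht.1.1 ht.1.2) (s.finite_toSet.isClosed.isOpen_compl.mem_nhds ht.2))
  have hlt : c < d := htcd.1.trans htcd.2
  have hIcc := (Ioo_subset_Ioo_iff hlt).1 (hcd.trans inter_subset_left)
  have hdiff := (hs c d hIcc.1 hlt hIcc.2 fun u hu hucd => (hcd hucd).2 hu).differentiableOn
    one_ne_zero
  exact (hg (γ t) (hγ.2 t (Ioo_subset_Icc_self ht.1))).scomp t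
    (hdiff.differentiableAt (Icc_mem_nhds htcd.1 htcd.2)).hasDerivAt |>.congr_deriv
    (by simp [lineIntegrand, mul_comm])

end IsCurveIn

theorem theorem1 (G : Set ℂ) (hGopen : IsOpen G) (hGsc : IsSimplyConnected G)
    (f : ℂ → ℂ) (hf : DifferentiableOn ℂ f G) :
    -- the line integral of `f` along every curve in `G` exists
    (∀ (γ : ℝ → ℂ) (a b : ℝ), IsCurveIn G γ a b →
      IntervalIntegrable (lineIntegrand f γ) MeasureTheory.volume a b) ∧
    -- it vanishes for every closed curve in `G`
    (∀ (γ : ℝ → ℂ) (a b : ℝ), IsCurveIn G γ a b → γ a = γ b →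
      lineIntegral f γ a b = 0) ∧
    -- it depends only on the two end points `A` and `B` of the path
    (∀ A ∈ G, ∀ B ∈ G, ∀ (γ₁ γ₂ : ℝ → ℂ) (a₁ b₁ a₂ b₂ : ℝ),
      IsCurveIn G γ₁ a₁ b₁ → γ₁ a₁ = A → γ₁ b₁ = B →
      IsCurveIn G γ₂ a₂ b₂ → γ₂ a₂ = A → γ₂ b₂ = B →
      lineIntegral f γ₁ a₁ b₁ = lineIntegral f γ₂ a₂ b₂) := by
  obtain ⟨g, hg⟩ := hf.isExactOn_of_isSimplyConnected hGopen hGsc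
  refine ⟨fun γ a b hγ => hγ.intervalIntegrable_lineIntegrand hf.continuousOn,
    fun γ a b hγ hclosed => ?_, ?_⟩
  · rw [hγ.lineIntegral_eq_sub hf.continuousOn hg, hclosed, sub_self]
  · rintro _ - _ - γ₁ γ₂ a₁ b₁ a₂ b₂ h₁ rfl rfl h₂ hA hB
    rw [h₁.lineIntegral_eq_sub hf.continuousOn hg, h₂.lineIntegral_eq_sub hf.continuousOn hg, hA, hB]
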